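/- Let $V$ be a finite-dimensional real vector space (for instance $V=\mathfrak g^*$, the dual of the Lie algebra of a compact torus), let $S[V]$ be its symmetric algebra, and let $X=(a_1,\dots,a_m)$ be a list of nonzero vectors (for instance characters of the torus) spanning $V$. A subspace $\underline s\subset V$ is called rational if it is spanned by the members of $X$ lying in it; $\mathcal S_X$ denotes the set of rational subspaces and $\mathcal S_X(k)$ the set of those of dimension $k$ (so $\mathcal S_X(-1)=\emptyset$). Put $d_X=\prod_{a\in X}a$ and $d_{X\setminus\underline s}=\prod_{a\in X,\,a\notin\underline s}a$ in $S[V]$ (products with multiplicity). Let $I_{\underline s}=S[V]\,d_{X\setminus\underline s}$, and for $Q\subset\mathcal S_X$ let $I_Q=\sum_{\underline s\in Q}I_{\underline s}$. In the localization $R_X=S[V][d_X^{-1}]$ let $R_{X,k}$ be the linear span of all fractions $f/\prod_i a_i^{n_i}$ with $f\in S[V]$, $n_i\ge 0$, for which the $a_i$ with $n_i\neq0$ span a subspace of dimension at most $k$ (so $R_{X,-1}=0$). Let $L=d_X^{-1}S[V]$, $L_k=L\cap R_{X,k}$, and let $I_k=d_XL_k$, an ideal of $S[V]$. A set $Q\subset\mathcal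 S_X$ is called admissible if for every $\underline s\in Q$ it contains all rational subspaces $\underline t\subset\underline s$. 1) For every integer $k\ge0$ and every subset $\mathcal G\subset\mathcal S_X(k)$, $$\Big(\sum_{\underline s\in\mathcal G}I_{\underline s}\Big)\cap I_{k-1}=\sum_{\substack{\underline t\in\mathcal S_X(k-1)\\ \underline t\subset\underline s\text{ for some }\underline s\in\mathcal G}}I_{\underline t}.$$ 2) Let $Q\subset\mathcal S_X$ be admissible and let $\underline s\in Q$ be an element whose dimension $k$ is maximal among the dimensions of the elements of $Q$. Then $$I_{\underline s}\cap I_{Q\setminus\{\underline s\}}=I_{\underline s}\cap I_{k-1}=\sum_{\substack{\underline t\in\mathcal S_X(k-1)\\ \underline t\subset\underline s}}I_{\underline t}.$$ -/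

import Mathlib

noncomputable section

namespace PolarOrder

/-- The symmetric algebra `S[V]` of a real vector space `V` (for `V = 𝔤*` it is the algebra of
polynomial functions on `𝔤`). -/
abbrev S (V : Type*) [AddCommGroup V] [Module ℝ V] : Type _ := SymmetricAlgebra ℝ V

variable {V : Type*} [AddCommGroup V] [Module ℝ V] {m : ℕ}

/-- A subspace `s` of `V` is rational relative to the list `X` if it is spanned by the members of
`X` that lie in it. -/
def IsRational (X : Fin m → V) (s : Submodule ℝ V) : Prop :=
  Submodule.span ℝ (Set.range X ∩ (s : Set V)) = s

/-- The set `𝒮_X` of all rational subspaces. -/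
def rationalSubspaces (X : Fin m → V) : Set (Submodule ℝ V) :=
  {s | IsRational X s}

/-- The set `𝒮_X(k)` of rational subspaces of dimension `k`. The index is an integer so that
`𝒮_X(k - 1)` is meaningful (and empty) for `k = 0`. -/
def rationalSubspacesOfDim (X : Fin m → V) (k : ℤ) : Set (Submodule ℝ V) :=
  {s | s ∈ rationalSubspaces X ∧ (Module.finrank ℝ s : ℤ) = k}

/-- `d_X`, the product in `S[V]` of all members of the list `X`. -/
def dProd (X : Fin m → V) : S V :=
  ∏ i, SymmetricAlgebra.ι ℝ V (X i)

open scoped Classical in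
/-- `d_{X \ s}`, the product in `S[V]` of the members of the list `X` (with multiplicity) that do
not lie in `s`. -/
def dCompl (X : Fin m → V) (s : Submodule ℝ V) : S V :=
  ∏ i with X i ∉ s, SymmetricAlgebra.ι ℝ V (X i)

/-- The principal ideal `I_s` of `S[V]` generated by `d_{X \ s}`. -/
def idealOf (X : Fin m → V) (s : Submodule ℝ V) : Ideal (S V) :=
  Ideal.span {dCompl X s}

/-- The ideal `I_Q`, the sum of the ideals `I_s` over `s ∈ Q`. -/
def idealSum (X : Fin m → V) (Q : Set (Submodule ℝ V)) : Ideal (S V) :=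
  ⨆ s ∈ Q, idealOf X s

/-- The localized algebra `R_X = S[V][d_X⁻¹]`. -/
abbrev R (X : Fin m → V) : Type _ := Localization.Away (dProd X)

/-- The filtration of `R_X` by polar order: `R_{X,k}` is spanned by all fractions
`f / ∏ i, (X i) ^ (n i)` such that the members of `X` which occur in the denominator span a subspace
of dimension at most `k`. It is zero for `k < 0`. -/
def polarFiltration (X : Fin m → V) (k : ℤ) : Submodule (S V) (R X) :=
  Submodule.span (S V)
    {q | ∃ (f : S V) (n : Fin m → ℕ),
      (Module.finrank ℝ (Submodule.span ℝ (X '' {i | n i ≠ 0})) : ℤ) ≤ k ∧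
      q * algebraMap (S V) (R X) (∏ i, SymmetricAlgebra.ι ℝ V (X i) ^ n i) =
        algebraMap (S V) (R X) f}

/-- The element `d_X⁻¹` of `R_X`. -/
def dInv (X : Fin m → V) : R X := IsLocalization.Away.invSelf (dProd X)

/-- The `S[V]`-submodule `L = d_X⁻¹ S[V]` of `R_X`. -/
def L (X : Fin m → V) : Submodule (S V) (R X) :=
  Submodule.span (S V) {dInv X}

/-- `L_k = L ∩ R_{X,k}`. -/
def LFiltration (X : Fin m → V) (k : ℤ) : Submodule (S V) (R X) :=
  L X ⊓ polarFiltration X k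

/-- The ideal `I_k = L_k d_X` of `S[V]`: it consists of all `f` such that `f d_X⁻¹ ∈ L_k`. -/
def polarIdeal (X : Fin m → V) (k : ℤ) : Ideal (S V) :=
  Submodule.comap (LinearMap.toSpanSingleton (S V) (R X) (dInv X)) (LFiltration X k)

/-- A set `Q` of rational subspaces is admissible if with every `s ∈ Q` it contains all rational
subspaces contained in `s`. -/
structure IsAdmissible (X : Fin m → V) (Q : Set (Submodule ℝ V)) : Prop where
  rational : Q ⊆ rationalSubspaces X
  down_closed : ∀ s ∈ Q, ∀ t ∈ rationalSubspaces X, t ≤ s → t ∈ Q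

end PolarOrder

end

/-!
Let `K` be the fraction field of `S[V]` and let `polarLT V K k` be the span of all fractions whose
denominator is a product of vectors of `V` lying in a subspace of dimension less than `k`. An
element `f` of `I_{k-1}` satisfies `f / d_X ∈ polarLT V K k`. For a rational subspace `s` one has
`d_{X \ s} / d_X = 1 / d_{X ∩ s}`, so that both parts of the theorem follow from one separation
statement, `mem_cocircuitIdeal_of_sum_mem_polarLT`: if `∑ f_s / d_{X ∩ s}`, summed over distinct
rational subspaces of dimension `k`, lies in `polarLT V K k`, then each `f_s` lies in the ideal
generated by the products `d_{(X ∩ s) \ t}`, where `t` runs over the rational hyperplanes of `s`.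
Multiplied by `d_{X \ s}` these products become the generators `d_{X \ t}` of the ideals `I_t`. The
remaining inclusions, such as `I_t ⊆ I_s` for `t ⊆ s`, are elementary.

The separation statement is proved by induction on the number of vectors in the list. Take a member
`a`, a linear form `l` with `l a = 1`, and the projection `p v = v - l v • a` with kernel `ℝ a`. The
substitution `v ↦ p v + l v • T` defines a Laurent expansion `K → K((T))` along `a`, under which
polar coefficients have polar order lower by one (`coeff_laurentAlong_mem_polarLT`): a subspace
that does not contain `a` contributes no pole, and a subspace `U` containing `a` is replaced by
`p U`, of dimension one less. The leading polar coefficient of the given sum is, up to a nonzero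
scalar, the sum of the same kind for the projected list, over the subspaces `p s` with `a ∈ s`
(`sum_map_projAlong_mem_polarLT`). By induction the `f_s` with `a ∈ s` lie in the required ideal
modulo `a` (`cocircuitIdeal_map_le`). After subtraction of elements of that ideal, which changes the
sum only by elements of `polarLT V K k`, these numerators become divisible by `a`. Cancelling `a`
yields a sum for the list without `a`, to which the induction hypothesis applies. A subspace `s`
that the remaining vectors no longer span does not matter, because `a` is then itself one of the
generators of its ideal (`ι_mem_cocircuitIdeal`).

Projections along `a` are taken as endomorphisms of `V`, and denominators are not restricted to the
given list, so that all lists in the induction share the same field and the same filtration.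
-/

open scoped Polynomial LaurentSeries

namespace PolarOrder

/-! ### Poles along subspaces -/

section Filtration

variable {V : Type*} [AddCommGroup V] [Module ℝ V]

theorem ι_ne_zero {v : V} (hv : v ≠ 0) : SymmetricAlgebra.ι ℝ V v ≠ 0 := by
  obtain ⟨l, hl⟩ := Module.Projective.exists_dual_eq_one ℝ hv
  intro h
  have h1 : SymmetricAlgebra.lift l (SymmetricAlgebra.ι ℝ V v) = 0 := by rw [h, map_zero]
  rw [SymmetricAlgebra.lift_ι_apply, hl] at h1
  exact one_ne_zero h1

variable (K : Type*) [Field K] [Algebra (S V) K]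

/-- The algebra of fractions over `S[V]` whose denominators are products of vectors of `U`, as a
subalgebra of a field `K` over `S[V]`. The vector `0` contributes only `0⁻¹ = 0`. -/
noncomputable def polesIn (U : Submodule ℝ V) : Subalgebra (S V) K :=
  Algebra.adjoin (S V) ((fun u => (algebraMap (S V) K (SymmetricAlgebra.ι ℝ V u))⁻¹) '' (U : Set V))

/-- The fractions of polar order less than `k`. All vectors of `V`, not only those of a given list,
are allowed in the denominators. -/
noncomputable def polarLT (V : Type*) [AddCommGroup V] [Module ℝ V] (K : Type*) [Field K]
    [Algebra (S V) K] (k : ℕ) : Submodule (S V) K :=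
  ⨆ U : {U : Submodule ℝ V // Module.finrank ℝ U < k}, Subalgebra.toSubmodule (polesIn K U.1)

variable {K}

theorem inv_mem_polesIn {U : Submodule ℝ V} {u : V} (hu : u ∈ U) :
    (algebraMap (S V) K (SymmetricAlgebra.ι ℝ V u))⁻¹ ∈ polesIn K U :=
  Algebra.subset_adjoin ⟨u, hu, rfl⟩

theorem inv_prod_mem_polesIn {κ : Type*} {E : Finset κ} {X : κ → V} {U : Submodule ℝ V}
    (n : κ → ℕ) (h : ∀ i ∈ E, n i ≠ 0 → X i ∈ U) :
    (algebraMap (S V) K (∏ i ∈ E, SymmetricAlgebra.ι ℝ V (X i) ^ n i))⁻¹ ∈ polesIn K U := by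
  rw [map_prod, ← Finset.prod_inv_distrib]
  refine Subalgebra.prod_mem _ fun i hi => ?_
  by_cases hn : n i = 0
  · rw [hn, pow_zero, map_one, inv_one]
    exact one_mem _
  · rw [map_pow, ← inv_pow]
    exact pow_mem (inv_mem_polesIn (h i hi hn)) _

theorem mem_polarLT {U : Submodule ℝ V} {k : ℕ} (hU : Module.finrank ℝ U < k) {x : K}
    (hx : x ∈ polesIn K U) : x ∈ polarLT V K k :=
  Submodule.mem_iSup_of_mem (⟨U, hU⟩ : {U : Submodule ℝ V // Module.finrank ℝ U < k}) hx

theorem polarLT_zero : polarLT V K 0 = ⊥ := by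
  rw [polarLT, eq_bot_iff]
  exact iSup_le fun U => absurd U.2 (Nat.not_lt_zero _)

end Filtration

/-! ### Laurent expansion along a vector -/

section Laurent

variable {V : Type*} [AddCommGroup V] [Module ℝ V]

/-- The linear endomorphism `v ↦ v - l v • a`. If `l a = 1` it is the projection onto `ker l` with
kernel `ℝ a`. -/
noncomputable def projAlong (l : V →ₗ[ℝ] ℝ) (a : V) : V →ₗ[ℝ] V :=
  LinearMap.id - l.smulRight a

theorem projAlong_apply (l : V →ₗ[ℝ] ℝ) (a v : V) : projAlong l a v = v - l v • a := rfl

theorem dual_projAlong {l : V →ₗ[ℝ] ℝ} {a : V} (hl : l a = 1) (v : V) :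
    l (projAlong l a v) = 0 := by
  simp [projAlong_apply, hl]

theorem mem_of_projAlong_eq_zero {l : V →ₗ[ℝ] ℝ} {a v : V} (h : projAlong l a v = 0)
    {U : Submodule ℝ V} (ha : a ∈ U) : v ∈ U := by
  rw [projAlong_apply, sub_eq_zero] at h
  exact h ▸ U.smul_mem _ ha

theorem projAlong_self {l : V →ₗ[ℝ] ℝ} {a : V} (hl : l a = 1) : projAlong l a a = 0 := by
  simp [projAlong_apply, hl]

theorem map_projAlong_sup {l : V →ₗ[ℝ] ℝ} {a : V} {U : Submodule ℝ V} (ha : a ∈ U) :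
    U.map (projAlong l a) ⊔ Submodule.span ℝ {a} = U := by
  apply le_antisymm
  · refine sup_le ?_ ((Submodule.span_singleton_le_iff_mem _ _).2 ha)
    rintro _ ⟨v, hv, rfl⟩
    exact U.sub_mem hv (U.smul_mem _ ha)
  · intro v hv
    exact Submodule.mem_sup.2 ⟨_, ⟨v, hv, rfl⟩, l v • a,
      Submodule.smul_mem _ _ (Submodule.mem_span_singleton_self a), by simp [projAlong_apply]⟩

theorem projAlong_mem_iff {l : V →ₗ[ℝ] ℝ} {a : V} (hl : l a = 1) {W : Submodule ℝ V}
    (hW : ∀ w ∈ W, l w = 0) {v : V} :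
    projAlong l a v ∈ W ↔ v ∈ W ⊔ Submodule.span ℝ {a} := by
  constructor
  · intro h
    exact Submodule.mem_sup.2 ⟨_, h, l v • a,
      Submodule.smul_mem _ _ (Submodule.mem_span_singleton_self a), by simp [projAlong_apply]⟩
  · intro h
    obtain ⟨w, hw, y, hy, rfl⟩ := Submodule.mem_sup.1 h
    obtain ⟨r, rfl⟩ := Submodule.mem_span_singleton.1 hy
    simpa [projAlong_apply, hW w hw, hl] using hw

theorem finrank_sup_of_dual [FiniteDimensional ℝ V] {l : V →ₗ[ℝ] ℝ} {a : V} (hl : l a = 1)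
    {W : Submodule ℝ V} (hW : ∀ w ∈ W, l w = 0) :
    Module.finrank ℝ (W ⊔ Submodule.span ℝ {a} : Submodule ℝ V) = Module.finrank ℝ W + 1 := by
  refine Submodule.finrank_sup_span_singleton fun h => ?_
  have := hW a h
  rw [hl] at this
  exact one_ne_zero this

theorem dual_map_projAlong {l : V →ₗ[ℝ] ℝ} {a : V} (hl : l a = 1) {U : Submodule ℝ V} :
    ∀ w ∈ U.map (projAlong l a), l w = 0 := by
  rintro _ ⟨v, -, rfl⟩
  exact dual_projAlong hl v

theorem finrank_map_projAlong [FiniteDimensional ℝ V] {l : V →ₗ[ℝ] ℝ} {a : V} (hl : l a = 1)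
    {U : Submodule ℝ V} (ha : a ∈ U) :
    Module.finrank ℝ (U.map (projAlong l a)) + 1 = Module.finrank ℝ U := by
  rw [← finrank_sup_of_dual hl (dual_map_projAlong hl), map_projAlong_sup ha]

/-- The algebra endomorphism of `S[V]` induced by `projAlong l a`: reduction modulo `a`. -/
noncomputable def reduceAlong (l : V →ₗ[ℝ] ℝ) (a : V) : S V →ₐ[ℝ] S V :=
  SymmetricAlgebra.lift (SymmetricAlgebra.ι ℝ V ∘ₗ projAlong l a)

@[simp]
theorem reduceAlong_ι (l : V →ₗ[ℝ] ℝ) (a v : V) :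
    reduceAlong l a (SymmetricAlgebra.ι ℝ V v) = SymmetricAlgebra.ι ℝ V (projAlong l a v) := by
  simp [reduceAlong]

theorem ι_dvd_sub_reduceAlong (l : V →ₗ[ℝ] ℝ) (a : V) (f : S V) :
    SymmetricAlgebra.ι ℝ V a ∣ f - reduceAlong l a f := by
  induction f using SymmetricAlgebra.induction with
  | algebraMap r => simp
  | ι v => exact ⟨algebraMap ℝ _ (l v), by
      rw [reduceAlong_ι, projAlong_apply, map_sub, map_smul, sub_sub_cancel, Algebra.smul_def,
        mul_comm]⟩
  | mul f g hf hg =>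
    rw [map_mul, show f * g - reduceAlong l a f * reduceAlong l a g =
      f * (g - reduceAlong l a g) + (f - reduceAlong l a f) * reduceAlong l a g by ring]
    exact dvd_add (hg.mul_left _) (hf.mul_right _)
  | add f g hf hg =>
    rw [map_add, add_sub_add_comm]
    exact dvd_add hf hg

/-- The algebra homomorphism `S[V] → S[V][T]` sending a vector `v` to `v - l v • a + l v • T`. -/
noncomputable def expandAlong (l : V →ₗ[ℝ] ℝ) (a : V) : S V →ₐ[ℝ] (S V)[X] :=
  SymmetricAlgebra.lift
    ((Algebra.ofId (S V) (S V)[X]).toLinearMap.restrictScalars ℝ ∘ₗ SymmetricAlgebra.ι ℝ V ∘ₗ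
      projAlong l a + l.smulRight Polynomial.X)

theorem expandAlong_ι (l : V →ₗ[ℝ] ℝ) (a v : V) :
    expandAlong l a (SymmetricAlgebra.ι ℝ V v) =
      Polynomial.C (SymmetricAlgebra.ι ℝ V (projAlong l a v)) + l v • Polynomial.X := by
  rw [expandAlong, SymmetricAlgebra.lift_ι_apply]
  rfl

/-- The substitution `T = a` is a left inverse of the expansion along `a`. -/
theorem eval_expandAlong (l : V →ₗ[ℝ] ℝ) (a : V) (f : S V) :
    (expandAlong l a f).eval (SymmetricAlgebra.ι ℝ V a) = f := by
  induction f using SymmetricAlgebra.induction with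
  | algebraMap r =>
    rw [AlgHom.commutes, IsScalarTower.algebraMap_apply ℝ (S V) (S V)[X],
      Polynomial.algebraMap_eq, Polynomial.eval_C]
  | ι v =>
    rw [expandAlong_ι, Polynomial.eval_add, Polynomial.eval_C, Polynomial.eval_smul,
      Polynomial.eval_X, ← map_smul, ← map_add, projAlong_apply, sub_add_cancel]
  | mul f g hf hg => rw [map_mul, Polynomial.eval_mul, hf, hg]
  | add f g hf hg => rw [map_add, Polynomial.eval_add, hf, hg]

theorem coeff_zero_expandAlong (l : V →ₗ[ℝ] ℝ) (a : V) (f : S V) :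
    (expandAlong l a f).coeff 0 = reduceAlong l a f := by
  induction f using SymmetricAlgebra.induction with
  | algebraMap r =>
    rw [AlgHom.commutes, AlgHom.commutes, IsScalarTower.algebraMap_apply ℝ (S V) (S V)[X],
      Polynomial.algebraMap_eq, Polynomial.coeff_C_zero]
  | ι v => simp [expandAlong_ι]
  | mul f g hf hg => rw [map_mul, Polynomial.mul_coeff_zero, hf, hg, map_mul]
  | add f g hf hg => rw [map_add, Polynomial.coeff_add, hf, hg, map_add]

variable (K : Type*) [Field K] [Algebra (S V) K]

/-- The expansion along `a` as a power series over the field `K`. -/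
noncomputable def seriesAlong (l : V →ₗ[ℝ] ℝ) (a : V) : S V →+* PowerSeries K :=
  (Polynomial.coeToPowerSeries.ringHom).comp
    ((Polynomial.mapRingHom (algebraMap (S V) K)).comp (expandAlong l a).toRingHom)

theorem coeff_seriesAlong (l : V →ₗ[ℝ] ℝ) (a : V) (f : S V) (n : ℕ) :
    PowerSeries.coeff n (seriesAlong K l a f) =
      algebraMap (S V) K ((expandAlong l a f).coeff n) := by
  simp [seriesAlong]

theorem constantCoeff_seriesAlong (l : V →ₗ[ℝ] ℝ) (a : V) (f : S V) :
    PowerSeries.constantCoeff (seriesAlong K l a f) = algebraMap (S V) K (reduceAlong l a f) := by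
  rw [← PowerSeries.coeff_zero_eq_constantCoeff_apply, coeff_seriesAlong, coeff_zero_expandAlong]

theorem seriesAlong_ι (l : V →ₗ[ℝ] ℝ) (a v : V) :
    seriesAlong K l a (SymmetricAlgebra.ι ℝ V v) =
      PowerSeries.C (algebraMap (S V) K (SymmetricAlgebra.ι ℝ V (projAlong l a v))) +
        PowerSeries.C (algebraMap (S V) K (algebraMap ℝ (S V) (l v))) * PowerSeries.X := by
  simp [seriesAlong, expandAlong_ι, Algebra.smul_def,
    IsScalarTower.algebraMap_apply ℝ (S V) (S V)[X]]

variable [IsFractionRing (S V) K]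

theorem ofPowerSeries_seriesAlong_injective (l : V →ₗ[ℝ] ℝ) (a : V) : Function.Injective
    ((HahnSeries.ofPowerSeries ℤ K).comp (seriesAlong K l a)) := by
  refine HahnSeries.ofPowerSeries_injective.comp ((Polynomial.coe_injective K).comp
    ((Polynomial.map_injective _ (IsFractionRing.injective (S V) K)).comp ?_))
  exact Function.LeftInverse.injective (eval_expandAlong l a)

/-- The Laurent expansion along `a` of the elements of the fraction field of `S[V]`: the vector
`v` is sent to `v - l v • a + l v • T`, so that `a` becomes the variable `T` if `l a = 1`. -/
noncomputable def laurentAlong (l : V →ₗ[ℝ] ℝ) (a : V) : K →+* K⸨X⸩ :=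
  IsFractionRing.lift (ofPowerSeries_seriesAlong_injective K l a)

variable {K}

theorem laurentAlong_algebraMap (l : V →ₗ[ℝ] ℝ) (a : V) (f : S V) :
    laurentAlong K l a (algebraMap (S V) K f) =
      HahnSeries.ofPowerSeries ℤ K (seriesAlong K l a f) :=
  IsFractionRing.lift_algebraMap (ofPowerSeries_seriesAlong_injective K l a) f

/-- A fraction whose denominator does not vanish modulo `a` has no pole along `a`. -/
theorem laurentAlong_div (l : V →ₗ[ℝ] ℝ) (a : V) (f : S V) {d : S V}
    (hd : reduceAlong l a d ≠ 0) :
    laurentAlong K l a (algebraMap (S V) K f / algebraMap (S V) K d) =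
      HahnSeries.ofPowerSeries ℤ K (seriesAlong K l a f * (seriesAlong K l a d)⁻¹) := by
  have hc : PowerSeries.constantCoeff (seriesAlong K l a d) ≠ 0 := by
    rw [constantCoeff_seriesAlong]
    exact (map_ne_zero_iff _ (IsFractionRing.injective (S V) K)).2 hd
  have hne : HahnSeries.ofPowerSeries ℤ K (seriesAlong K l a d) ≠ 0 := by
    rw [Ne, map_eq_zero_iff _ HahnSeries.ofPowerSeries_injective]
    rintro h
    rw [h, map_zero] at hc
    exact hc rfl
  rw [map_div₀, laurentAlong_algebraMap, laurentAlong_algebraMap, map_mul, div_eq_iff hne,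
    mul_assoc, ← map_mul, PowerSeries.inv_mul_cancel _ hc, map_one, mul_one]

end Laurent

/-! ### Polar coefficients and polar order -/

section Coefficients

variable {K : Type*} [Field K]

/-- The Laurent series over `K` with coefficients in a subring `A`. -/
def laurentCoeffsIn (A : Subring K) : Subring K⸨X⸩ where
  carrier := {x | ∀ n, x.coeff n ∈ A}
  mul_mem' {x y} hx hy n := by
    rw [HahnSeries.coeff_mul]
    exact A.sum_mem fun ij _ => A.mul_mem (hx _) (hy _)
  one_mem' n := by
    rw [HahnSeries.coeff_one]
    split_ifs
    exacts [A.one_mem, A.zero_mem]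
  add_mem' {x y} hx hy n := A.add_mem (hx n) (hy n)
  zero_mem' n := A.zero_mem
  neg_mem' {x} hx n := A.neg_mem (hx n)

theorem ofPowerSeries_mem_laurentCoeffsIn {A : Subring K} {φ : PowerSeries K}
    (h : ∀ n, PowerSeries.coeff n φ ∈ A) :
    HahnSeries.ofPowerSeries ℤ K φ ∈ laurentCoeffsIn A := by
  intro n
  rw [PowerSeries.coeff_coe]
  split_ifs
  exacts [A.zero_mem, h _]

theorem single_mem_laurentCoeffsIn {A : Subring K} (n : ℤ) {c : K} (hc : c ∈ A) :
    (HahnSeries.single n c : K⸨X⸩) ∈ laurentCoeffsIn A := by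
  intro k
  rw [HahnSeries.coeff_single]
  split_ifs
  exacts [hc, A.zero_mem]

/-- The coefficients of the geometric series `(w + r T)⁻¹` are polynomials in `w⁻¹` and `r`. -/
theorem coeff_inv_linear_mem {A : Subring K} {w r : K} (hw0 : w ≠ 0) (hw : w⁻¹ ∈ A) (hr : r ∈ A)
    (n : ℕ) :
    PowerSeries.coeff n (PowerSeries.C w + PowerSeries.C r * PowerSeries.X)⁻¹ ∈ A := by
  set ψ := PowerSeries.C w + PowerSeries.C r * PowerSeries.X with hψ
  have hc : PowerSeries.constantCoeff ψ = w := by simp [hψ]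
  induction n with
  | zero =>
    rw [PowerSeries.coeff_zero_eq_constantCoeff_apply, PowerSeries.constantCoeff_inv, hc]
    exact hw
  | succ n ih =>
    have h1 : ψ * ψ⁻¹ = 1 := PowerSeries.mul_inv_cancel _ (by rwa [hc])
    have h2 := congrArg (PowerSeries.coeff (n + 1)) h1
    rw [hψ, add_mul, mul_assoc, map_add, PowerSeries.coeff_C_mul, PowerSeries.coeff_C_mul,
      PowerSeries.coeff_succ_X_mul, ← hψ, PowerSeries.coeff_one, if_neg (Nat.succ_ne_zero n)] at h2
    have h3 : PowerSeries.coeff (n + 1) ψ⁻¹ = -(w⁻¹ * (r * PowerSeries.coeff n ψ⁻¹)) := by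
      field_simp
      linear_combination h2
    rw [h3]
    exact A.neg_mem (A.mul_mem hw (A.mul_mem hr ih))

end Coefficients

section PolarCoefficients

variable {V : Type*} [AddCommGroup V] [Module ℝ V] {K : Type*} [Field K] [Algebra (S V) K]
  [IsFractionRing (S V) K]

theorem laurentAlong_ι_of_projAlong_eq_zero {l : V →ₗ[ℝ] ℝ} {a u : V} (h : projAlong l a u = 0) :
    laurentAlong K l a (algebraMap (S V) K (SymmetricAlgebra.ι ℝ V u)) =
      HahnSeries.single 1 (algebraMap (S V) K (algebraMap ℝ (S V) (l u))) := by
  rw [laurentAlong_algebraMap, seriesAlong_ι, h, map_zero, map_zero, map_zero, zero_add, map_mul,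
    HahnSeries.ofPowerSeries_C, HahnSeries.ofPowerSeries_X, HahnSeries.C_apply,
    HahnSeries.single_mul_single, zero_add, mul_one]

theorem laurentAlong_inv_ι {l : V →ₗ[ℝ] ℝ} {a u : V} (h : projAlong l a u ≠ 0) :
    laurentAlong K l a (algebraMap (S V) K (SymmetricAlgebra.ι ℝ V u))⁻¹ =
      HahnSeries.ofPowerSeries ℤ K (seriesAlong K l a (SymmetricAlgebra.ι ℝ V u))⁻¹ := by
  have := laurentAlong_div (K := K) l a 1 (d := SymmetricAlgebra.ι ℝ V u)
    (by rw [reduceAlong_ι]; exact ι_ne_zero h)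
  rwa [map_one, map_one, one_mul, one_div] at this

/-- The Laurent coefficients along `a` of a fraction with poles in `U` have poles in the projection
of `U`: a multiple of `a` is inverted to a multiple of `T⁻¹`, and any other `u` to a geometric
series in which only powers of `(p u)⁻¹` occur. -/
theorem laurentAlong_mem_of_mem {l : V →ₗ[ℝ] ℝ} {a : V} {U : Submodule ℝ V}
    {x : K} (hx : x ∈ polesIn K U) :
    laurentAlong K l a x ∈ laurentCoeffsIn (polesIn K (U.map (projAlong l a))).toSubring := by
  refine Algebra.adjoin_induction ?_ ?_ ?_ ?_ hx
  · rintro _ ⟨u, hu, rfl⟩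
    by_cases h : projAlong l a u = 0
    · dsimp only
      rw [map_inv₀, laurentAlong_ι_of_projAlong_eq_zero h, HahnSeries.inv_single]
      refine single_mem_laurentCoeffsIn _ ?_
      have : ((algebraMap (S V) K) (algebraMap ℝ (S V) (l u)))⁻¹ =
          (algebraMap (S V) K) (algebraMap ℝ (S V) (l u)⁻¹) :=
        (map_inv₀ ((algebraMap (S V) K).comp (algebraMap ℝ (S V))) (l u)).symm
      rw [this]
      exact Subalgebra.algebraMap_mem _ _
    · dsimp only
      rw [laurentAlong_inv_ι h, seriesAlong_ι]
      refine ofPowerSeries_mem_laurentCoeffsIn (coeff_inv_linear_mem ?_ ?_ ?_)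
      · exact (map_ne_zero_iff _ (IsFractionRing.injective (S V) K)).2 (ι_ne_zero h)
      · exact inv_mem_polesIn (Submodule.mem_map_of_mem hu)
      · exact Subalgebra.algebraMap_mem _ _
  · intro f
    rw [laurentAlong_algebraMap]
    refine ofPowerSeries_mem_laurentCoeffsIn fun n => ?_
    rw [coeff_seriesAlong]
    exact Subalgebra.algebraMap_mem _ _
  · intro x y _ _ hx hy
    rw [map_add]
    exact add_mem hx hy
  · intro x y _ _ hx hy
    rw [map_mul]
    exact mul_mem hx hy

/-- Fractions with poles in a subspace that does not contain `a` have no pole along `a`. -/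
theorem laurentAlong_regular {l : V →ₗ[ℝ] ℝ} {a : V} {U : Submodule ℝ V}
    (ha : a ∉ U) {x : K} (hx : x ∈ polesIn K U) :
    laurentAlong K l a x ∈ (HahnSeries.ofPowerSeries ℤ K).range := by
  refine Algebra.adjoin_induction ?_ ?_ ?_ ?_ hx
  · rintro _ ⟨u, hu, rfl⟩
    by_cases h : projAlong l a u = 0
    · have hu0 : u = 0 := by
        rw [projAlong_apply, sub_eq_zero] at h
        by_contra hne
        have hlu : l u ≠ 0 := fun h0 => hne (by rw [h, h0, zero_smul])
        exact ha ((U.smul_mem_iff hlu).1 (h ▸ hu))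
      dsimp only
      rw [hu0, map_zero, map_zero, inv_zero, map_zero]
      exact zero_mem _
    · exact ⟨_, (laurentAlong_inv_ι h).symm⟩
  · intro f
    exact ⟨_, (laurentAlong_algebraMap l a f).symm⟩
  · intro x y _ _ hx hy
    rw [map_add]
    exact add_mem hx hy
  · intro x y _ _ hx hy
    rw [map_mul]
    exact mul_mem hx hy

theorem coeff_ofPowerSeries_of_neg {φ : PowerSeries K} {n : ℤ} (hn : n < 0) :
    (HahnSeries.ofPowerSeries ℤ K φ).coeff n = 0 := by
  rw [PowerSeries.coeff_coe, if_pos hn]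

/-- Taking a polar coefficient along `a` lowers the polar order: denominators from a subspace `U`
contribute only if `a ∈ U`, and then the coefficients have denominators from the projection of
`U` along `a`. -/
theorem coeff_laurentAlong_mem_polarLT [FiniteDimensional ℝ V] {l : V →ₗ[ℝ] ℝ} {a : V}
    (hl : l a = 1) {k : ℕ} {x : K} (hx : x ∈ polarLT V K k) {n : ℤ} (hn : n < 0) :
    (laurentAlong K l a x).coeff n ∈ polarLT V K (k - 1) := by
  refine Submodule.iSup_induction _ (motive := fun x =>
    (laurentAlong K l a x).coeff n ∈ polarLT V K (k - 1)) hx ?_ ?_ ?_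
  · rintro ⟨U, hU⟩ x hx
    by_cases ha : a ∈ U
    · have := finrank_map_projAlong hl ha
      exact mem_polarLT (U := U.map (projAlong l a)) (by omega) (laurentAlong_mem_of_mem hx n)
    · obtain ⟨φ, hφ⟩ := laurentAlong_regular (l := l) ha hx
      rw [← hφ, coeff_ofPowerSeries_of_neg hn]
      exact zero_mem _
  · rw [map_zero, HahnSeries.coeff_zero]
    exact zero_mem _
  · intro x y hx hy
    rw [map_add, HahnSeries.coeff_add]
    exact add_mem hx hy

/-- The leading polar coefficient along `a` of a fraction `f / (d₀ d₁)`, where `d₀` is a product of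
`e` multiples of `a` and `d₁` does not vanish modulo `a`. -/
theorem coeff_laurentAlong_div {l : V →ₗ[ℝ] ℝ} {a : V} {κ : Type*} {X : κ → V} {E₀ : Finset κ}
    (h₀ : ∀ i ∈ E₀, projAlong l a (X i) = 0) (f : S V) {d : S V} (hd : reduceAlong l a d ≠ 0) :
    (laurentAlong K l a (algebraMap (S V) K f /
      algebraMap (S V) K ((∏ i ∈ E₀, SymmetricAlgebra.ι ℝ V (X i)) * d))).coeff (-(E₀.card : ℤ)) =
    algebraMap (S V) K (algebraMap ℝ (S V) (∏ i ∈ E₀, l (X i))⁻¹) *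
      (algebraMap (S V) K (reduceAlong l a f) / algebraMap (S V) K (reduceAlong l a d)) := by
  have h1 : laurentAlong K l a (algebraMap (S V) K (∏ i ∈ E₀, SymmetricAlgebra.ι ℝ V (X i))) =
      HahnSeries.single (E₀.card : ℤ)
        (algebraMap (S V) K (algebraMap ℝ (S V) (∏ i ∈ E₀, l (X i)))) := by
    classical
    induction E₀ using Finset.induction_on with
    | empty => simp
    | insert i E₀ hi ih =>
      rw [Finset.prod_insert hi, map_mul, map_mul,
        ih fun j hj => h₀ j (Finset.mem_insert_of_mem hj),
        laurentAlong_ι_of_projAlong_eq_zero (h₀ i (Finset.mem_insert_self _ _)),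
        HahnSeries.single_mul_single, Finset.prod_insert hi, Finset.card_insert_of_notMem hi,
        Nat.cast_succ, add_comm, (algebraMap ℝ (S V)).map_mul, (algebraMap (S V) K).map_mul]
  have h2 : ((algebraMap (S V) K) (algebraMap ℝ (S V) (∏ i ∈ E₀, l (X i))))⁻¹ =
      (algebraMap (S V) K) (algebraMap ℝ (S V) (∏ i ∈ E₀, l (X i))⁻¹) :=
    (map_inv₀ ((algebraMap (S V) K).comp (algebraMap ℝ (S V))) _).symm
  rw [map_mul, mul_comm, ← div_div, div_eq_mul_inv, mul_comm, map_mul, map_inv₀, h1,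
    HahnSeries.inv_single, laurentAlong_div l a f hd, HahnSeries.coeff_single_mul, sub_self, h2,
    PowerSeries.coeff_coe, if_neg (lt_irrefl 0), Int.natAbs_zero,
    PowerSeries.coeff_zero_eq_constantCoeff_apply, map_mul, PowerSeries.constantCoeff_inv,
    constantCoeff_seriesAlong, constantCoeff_seriesAlong, div_eq_mul_inv]

end PolarCoefficients

/-! ### Cocircuit ideals -/

section Cocircuit

open scoped Classical

variable {V : Type*} [AddCommGroup V] [Module ℝ V] {κ : Type*}

/-- The product in `S[V]` of the vectors `X i`, `i ∈ E`, that lie in `s`. -/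
noncomputable def partProd (E : Finset κ) (X : κ → V) (s : Submodule ℝ V) : S V :=
  ∏ i ∈ E with X i ∈ s, SymmetricAlgebra.ι ℝ V (X i)

/-- The product in `S[V]` of the vectors `X i`, `i ∈ E`, that lie in `s` but not in `t`. -/
noncomputable def diffProd (E : Finset κ) (X : κ → V) (s t : Submodule ℝ V) : S V :=
  ∏ i ∈ E with X i ∈ s ∧ X i ∉ t, SymmetricAlgebra.ι ℝ V (X i)

/-- The subspace `s` is spanned by the vectors `X i`, `i ∈ E`, that lie in it. -/
def IsSpannedIn (E : Finset κ) (X : κ → V) (s : Submodule ℝ V) : Prop :=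
  Submodule.span ℝ (X '' {i | i ∈ E ∧ X i ∈ s}) = s

/-- The ideal generated by the cocircuits of the list of the vectors `X i`, `i ∈ E`, lying in `s`:
its generators are the products of the members outside a hyperplane of `s` spanned by members. -/
def cocircuitIdeal (E : Finset κ) (X : κ → V) (s : Submodule ℝ V) : Ideal (S V) :=
  Ideal.span {g | ∃ t, IsSpannedIn E X t ∧ t ≤ s ∧
    Module.finrank ℝ t + 1 = Module.finrank ℝ s ∧ diffProd E X s t = g}

variable {E : Finset κ} {X : κ → V} {s t : Submodule ℝ V}

theorem span_image_le : Submodule.span ℝ (X '' {i | i ∈ E ∧ X i ∈ s}) ≤ s :=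
  Submodule.span_le.2 (by rintro _ ⟨i, hi, rfl⟩; exact hi.2)

theorem isSpannedIn_iff_le :
    IsSpannedIn E X s ↔ s ≤ Submodule.span ℝ (X '' {i | i ∈ E ∧ X i ∈ s}) :=
  ⟨fun h => h.ge, fun h => le_antisymm span_image_le h⟩

theorem IsSpannedIn.mono {E' : Finset κ} (h : IsSpannedIn E' X s) (hE : E' ⊆ E) :
    IsSpannedIn E X s := by
  rw [isSpannedIn_iff_le] at h ⊢
  exact h.trans (Submodule.span_mono (Set.image_mono fun i hi => ⟨hE hi.1, hi.2⟩))

theorem isSpannedIn_span {E' : Finset κ} (hE : E' ⊆ E) :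
    IsSpannedIn E X (Submodule.span ℝ (X '' {i | i ∈ E' ∧ X i ∈ s})) := by
  rw [isSpannedIn_iff_le]
  exact Submodule.span_mono (Set.image_mono fun i hi =>
    ⟨hE hi.1, Submodule.subset_span ⟨i, hi, rfl⟩⟩)

theorem partProd_ne_zero (hX : ∀ i ∈ E, X i ≠ 0) : partProd E X s ≠ 0 :=
  Finset.prod_ne_zero_iff.2 fun i hi => ι_ne_zero (hX i (Finset.mem_filter.1 hi).1)

theorem partProd_mul_diffProd (h : t ≤ s) :
    partProd E X t * diffProd E X s t = partProd E X s := by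
  rw [partProd, diffProd, partProd, ← Finset.prod_filter_mul_prod_filter_not
    (E.filter fun i => X i ∈ s) (fun i => X i ∈ t), Finset.filter_filter, Finset.filter_filter]
  congr 1
  refine Finset.prod_congr (Finset.filter_congr fun i _ => ?_) fun _ _ => rfl
  exact ⟨fun hi => ⟨h hi, hi⟩, fun hi => hi.2⟩

theorem diffProd_mem_cocircuitIdeal (ht : IsSpannedIn E X t) (h : t ≤ s)
    (hd : Module.finrank ℝ t + 1 = Module.finrank ℝ s) :
    diffProd E X s t ∈ cocircuitIdeal E X s :=
  Ideal.subset_span ⟨t, ht, h, hd, rfl⟩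

section Fractions

variable {K : Type*} [Field K] [Algebra (S V) K]

theorem div_partProd_mem_polarLT {k : ℕ} {U : Submodule ℝ V} (hU : Module.finrank ℝ U < k)
    (h : ∀ i ∈ E, X i ∈ s → X i ∈ U) (f : S V) :
    algebraMap (S V) K f / algebraMap (S V) K (partProd E X s) ∈ polarLT V K k := by
  refine mem_polarLT hU ?_
  rw [div_eq_mul_inv]
  refine mul_mem (Subalgebra.algebraMap_mem _ _) ?_
  have := inv_prod_mem_polesIn (K := K) (E := E.filter fun i => X i ∈ s) (X := X) (U := U)
    (fun _ => 1) (fun i hi _ => h i (Finset.mem_filter.1 hi).1 (Finset.mem_filter.1 hi).2)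
  simp only [pow_one] at this
  exact this

/-- For a hyperplane `t` of `s`, dividing the cocircuit of `t` by the product of the members in `s`
cancels all factors outside `t`; hence the drop in polar order. -/
theorem div_partProd_mem_of_mem_cocircuitIdeal [IsFractionRing (S V) K]
    (hX : ∀ i ∈ E, X i ≠ 0) {c : S V}
    (hc : c ∈ cocircuitIdeal E X s) :
    algebraMap (S V) K c / algebraMap (S V) K (partProd E X s) ∈
      polarLT V K (Module.finrank ℝ s) := by
  have hle : cocircuitIdeal E X s ≤ (polarLT V K (Module.finrank ℝ s)).comap
      (LinearMap.toSpanSingleton (S V) K (algebraMap (S V) K (partProd E X s))⁻¹) := by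
    refine Ideal.span_le.2 ?_
    rintro _ ⟨t, -, hts, hd, rfl⟩
    change diffProd E X s t • (algebraMap (S V) K (partProd E X s))⁻¹ ∈
      polarLT V K (Module.finrank ℝ s)
    have h0 : diffProd E X s t ≠ 0 := by
      intro h
      have := partProd_mul_diffProd (E := E) (X := X) hts
      rw [h, mul_zero] at this
      exact partProd_ne_zero hX this.symm
    have h0' : algebraMap (S V) K (diffProd E X s t) ≠ 0 :=
      (map_ne_zero_iff _ (IsFractionRing.injective (S V) K)).2 h0
    rw [Algebra.smul_def, ← partProd_mul_diffProd hts, map_mul, mul_inv, mul_comm, mul_assoc,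
      inv_mul_cancel₀ h0', mul_one, ← one_div, ← map_one (algebraMap (S V) K)]
    exact div_partProd_mem_polarLT (K := K) (U := t) (by omega) (fun i _ h => h) 1
  have := hle hc
  rw [div_eq_mul_inv, ← Algebra.smul_def]
  exact this

end Fractions

/-! ### Deletion of a vector -/

section Deletion

variable {i₀ : κ}

theorem partProd_erase_of_mem (hi : i₀ ∈ E) (ha : X i₀ ∈ s) :
    partProd E X s = SymmetricAlgebra.ι ℝ V (X i₀) * partProd (E.erase i₀) X s := by
  rw [partProd, partProd, Finset.filter_erase]
  exact (Finset.mul_prod_erase _ (fun i => SymmetricAlgebra.ι ℝ V (X i))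
    (Finset.mem_filter.2 ⟨hi, ha⟩)).symm

theorem partProd_erase_of_notMem (ha : X i₀ ∉ s) :
    partProd (E.erase i₀) X s = partProd E X s := by
  rw [partProd, partProd, Finset.filter_erase, Finset.erase_eq_of_notMem]
  exact fun h => ha (Finset.mem_filter.1 h).2

theorem isSpannedIn_erase_of_notMem (ha : X i₀ ∉ s) (h : IsSpannedIn E X s) :
    IsSpannedIn (E.erase i₀) X s := by
  rw [isSpannedIn_iff_le] at h ⊢
  refine h.trans (Submodule.span_mono (Set.image_mono fun i hi =>
    ⟨Finset.mem_erase.2 ⟨?_, hi.1⟩, hi.2⟩))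
  rintro rfl
  exact ha hi.2

theorem diffProd_dvd_erase :
    diffProd E X s t ∣ SymmetricAlgebra.ι ℝ V (X i₀) * diffProd (E.erase i₀) X s t := by
  have h : E.filter (fun i => X i ∈ s ∧ X i ∉ t) ⊆
      insert i₀ ((E.erase i₀).filter fun i => X i ∈ s ∧ X i ∉ t) := by
    intro i hi
    rw [Finset.mem_filter] at hi
    by_cases h : i = i₀
    · exact h ▸ Finset.mem_insert_self _ _
    · exact Finset.mem_insert_of_mem (Finset.mem_filter.2 ⟨Finset.mem_erase.2 ⟨h, hi.1⟩, hi.2⟩)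
  have := Finset.prod_dvd_prod_of_subset _ _ (fun i => SymmetricAlgebra.ι ℝ V (X i)) h
  rw [Finset.prod_insert (by simp)] at this
  exact this

theorem diffProd_erase_of_notMem (ha : X i₀ ∉ s) :
    diffProd (E.erase i₀) X s t = diffProd E X s t := by
  rw [diffProd, diffProd, Finset.filter_erase, Finset.erase_eq_of_notMem]
  exact fun h => ha (Finset.mem_filter.1 h).2.1

theorem mul_mem_cocircuitIdeal_of_erase {c : S V}
    (hc : c ∈ cocircuitIdeal (E.erase i₀) X s) :
    SymmetricAlgebra.ι ℝ V (X i₀) * c ∈ cocircuitIdeal E X s := by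
  have hle : cocircuitIdeal (E.erase i₀) X s ≤ Submodule.comap
      (LinearMap.mulLeft (S V) (SymmetricAlgebra.ι ℝ V (X i₀))) (cocircuitIdeal E X s) := by
    refine Ideal.span_le.2 ?_
    rintro _ ⟨t, ht, hts, hd, rfl⟩
    exact Ideal.mem_of_dvd (cocircuitIdeal E X s) diffProd_dvd_erase
      (diffProd_mem_cocircuitIdeal (ht.mono (Finset.erase_subset _ _)) hts hd)
  exact hle hc

theorem cocircuitIdeal_erase_le_of_notMem (ha : X i₀ ∉ s) :
    cocircuitIdeal (E.erase i₀) X s ≤ cocircuitIdeal E X s := by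
  refine Ideal.span_le.2 ?_
  rintro _ ⟨t, ht, hts, hd, rfl⟩
  rw [diffProd_erase_of_notMem ha]
  exact diffProd_mem_cocircuitIdeal (ht.mono (Finset.erase_subset _ _)) hts hd

variable (hs : IsSpannedIn E X s) (hs' : ¬ IsSpannedIn (E.erase i₀) X s)
include hs hs'

theorem mem_of_not_isSpannedIn_erase : X i₀ ∈ s := by
  by_contra h
  exact hs' (isSpannedIn_erase_of_notMem h hs)

theorem span_erase_sup : Submodule.span ℝ (X '' {i | i ∈ E.erase i₀ ∧ X i ∈ s}) ⊔
    Submodule.span ℝ {X i₀} = s := by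
  refine le_antisymm (sup_le span_image_le ((Submodule.span_singleton_le_iff_mem _ _).2
    (mem_of_not_isSpannedIn_erase hs hs'))) ?_
  refine (isSpannedIn_iff_le.1 hs).trans (Submodule.span_le.2 ?_)
  rintro _ ⟨i, hi, rfl⟩
  by_cases h : i = i₀
  · subst h
    exact Submodule.mem_sup_right (Submodule.mem_span_singleton_self _)
  · exact Submodule.mem_sup_left
      (Submodule.subset_span ⟨i, ⟨Finset.mem_erase.2 ⟨h, hi.1⟩, hi.2⟩, rfl⟩)

theorem notMem_span_erase : X i₀ ∉ Submodule.span ℝ (X '' {i | i ∈ E.erase i₀ ∧ X i ∈ s}) := by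
  intro h
  refine hs' (isSpannedIn_iff_le.2 ?_)
  conv_lhs => rw [← span_erase_sup hs hs']
  exact sup_le le_rfl ((Submodule.span_singleton_le_iff_mem _ _).2 h)

theorem finrank_span_erase [FiniteDimensional ℝ V] :
    Module.finrank ℝ (Submodule.span ℝ (X '' {i | i ∈ E.erase i₀ ∧ X i ∈ s})) + 1 =
      Module.finrank ℝ s := by
  rw [← Submodule.finrank_sup_span_singleton (notMem_span_erase hs hs'), span_erase_sup hs hs']

/-- If the members in `s` other than `X i₀` fail to span `s`, then `X i₀` is by itself a
cocircuit. -/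
theorem ι_mem_cocircuitIdeal [FiniteDimensional ℝ V] (hi : i₀ ∈ E) :
    SymmetricAlgebra.ι ℝ V (X i₀) ∈ cocircuitIdeal E X s := by
  have h := diffProd_mem_cocircuitIdeal (isSpannedIn_span (X := X) (s := s)
    (Finset.erase_subset i₀ E)) span_image_le (finrank_span_erase hs hs')
  convert h
  have hf : E.filter (fun i => X i ∈ s ∧
      X i ∉ Submodule.span ℝ (X '' {i | i ∈ E.erase i₀ ∧ X i ∈ s})) = {i₀} := by
    ext i
    rw [Finset.mem_filter, Finset.mem_singleton]
    constructor
    · rintro ⟨h1, h2, h3⟩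
      by_contra h
      exact h3 (Submodule.subset_span ⟨i, ⟨Finset.mem_erase.2 ⟨h, h1⟩, h2⟩, rfl⟩)
    · rintro rfl
      exact ⟨hi, mem_of_not_isSpannedIn_erase hs hs', notMem_span_erase hs hs'⟩
  rw [diffProd]
  trans ∏ i ∈ {i₀}, SymmetricAlgebra.ι ℝ V (X i)
  · rw [Finset.prod_singleton]
  · rw [← hf]

end Deletion

/-! ### Projection along a vector -/

section Contraction

variable {l : V →ₗ[ℝ] ℝ} {a : V}

/-- The indices in `E` of the vectors that are not multiples of `a`. -/
noncomputable def transverse (E : Finset κ) (X : κ → V) (l : V →ₗ[ℝ] ℝ) (a : V) : Finset κ :=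
  E.filter fun i => projAlong l a (X i) ≠ 0

theorem mem_transverse {i : κ} : i ∈ transverse E X l a ↔ i ∈ E ∧ projAlong l a (X i) ≠ 0 :=
  Finset.mem_filter

theorem projAlong_mem_map_iff (hl : l a = 1) (ha : a ∈ s) {v : V} :
    projAlong l a v ∈ s.map (projAlong l a) ↔ v ∈ s := by
  rw [projAlong_mem_iff hl (dual_map_projAlong hl), map_projAlong_sup ha]

theorem IsSpannedIn.map (hl : l a = 1) (ha : a ∈ s) (hs : IsSpannedIn E X s) :
    IsSpannedIn (transverse E X l a) (projAlong l a ∘ X) (s.map (projAlong l a)) := by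
  rw [isSpannedIn_iff_le]
  conv_lhs => rw [← hs]
  rw [Submodule.map_span, Submodule.span_le]
  rintro _ ⟨_, ⟨i, hi, rfl⟩, rfl⟩
  by_cases h : projAlong l a (X i) = 0
  · rw [h]
    exact zero_mem _
  · exact Submodule.subset_span
      ⟨i, ⟨mem_transverse.2 ⟨hi.1, h⟩, (projAlong_mem_map_iff hl ha).2 hi.2⟩, rfl⟩

theorem IsSpannedIn.dual_eq_zero (hl : l a = 1)
    (ht : IsSpannedIn (transverse E X l a) (projAlong l a ∘ X) t) : ∀ w ∈ t, l w = 0 := by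
  have : t ≤ LinearMap.ker l := by
    rw [← ht, Submodule.span_le]
    rintro _ ⟨i, -, rfl⟩
    exact dual_projAlong hl _
  exact this

theorem IsSpannedIn.sup (hl : l a = 1) {i₀ : κ} (hi : i₀ ∈ E) (ha : X i₀ = a)
    (ht : IsSpannedIn (transverse E X l a) (projAlong l a ∘ X) t) :
    IsSpannedIn E X (t ⊔ Submodule.span ℝ {a}) := by
  have ha' : a ∈ t ⊔ Submodule.span ℝ {a} :=
    Submodule.mem_sup_right (Submodule.mem_span_singleton_self a)
  have hmem : a ∈ Submodule.span ℝ (X '' {i | i ∈ E ∧ X i ∈ t ⊔ Submodule.span ℝ {a}}) :=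
    Submodule.subset_span ⟨i₀, ⟨hi, ha.symm ▸ ha'⟩, ha⟩
  rw [isSpannedIn_iff_le]
  refine sup_le ?_ ((Submodule.span_singleton_le_iff_mem _ _).2 hmem)
  conv_lhs => rw [← ht]
  rw [Submodule.span_le]
  rintro _ ⟨i, hi, rfl⟩
  exact sub_mem (Submodule.subset_span ⟨i, ⟨(mem_transverse.1 hi.1).1,
    (projAlong_mem_iff hl (ht.dual_eq_zero hl)).1 hi.2⟩, rfl⟩) (Submodule.smul_mem _ _ hmem)

theorem reduceAlong_prod (F : Finset κ) :
    reduceAlong l a (∏ i ∈ F, SymmetricAlgebra.ι ℝ V (X i)) =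
      ∏ i ∈ F, SymmetricAlgebra.ι ℝ V ((projAlong l a ∘ X) i) := by
  rw [map_prod]
  exact Finset.prod_congr rfl fun i _ => reduceAlong_ι l a (X i)

theorem reduceAlong_diffProd (hl : l a = 1) (ha : a ∈ s)
    (ht : IsSpannedIn (transverse E X l a) (projAlong l a ∘ X) t) :
    reduceAlong l a (diffProd E X s (t ⊔ Submodule.span ℝ {a})) =
      diffProd (transverse E X l a) (projAlong l a ∘ X) (s.map (projAlong l a)) t := by
  rw [diffProd, diffProd, reduceAlong_prod]
  refine Finset.prod_congr ?_ fun _ _ => rfl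
  ext i
  rw [Finset.mem_filter, Finset.mem_filter, mem_transverse, Function.comp_apply,
    projAlong_mem_map_iff hl ha, projAlong_mem_iff hl (ht.dual_eq_zero hl)]
  refine ⟨fun h => ⟨⟨h.1, fun h0 => h.2.2 ?_⟩, h.2⟩, fun h => ⟨h.1.1, h.2⟩⟩
  rw [← projAlong_mem_iff hl (ht.dual_eq_zero hl), h0]
  exact zero_mem _

theorem reduceAlong_partProd (hl : l a = 1) (ha : a ∈ s) :
    reduceAlong l a (partProd (transverse E X l a) X s) =
      partProd (transverse E X l a) (projAlong l a ∘ X) (s.map (projAlong l a)) := by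
  rw [partProd, partProd, reduceAlong_prod]
  refine Finset.prod_congr (Finset.filter_congr fun i _ => ?_) fun _ _ => rfl
  exact (projAlong_mem_map_iff hl ha).symm

/-- Modulo `a`, the cocircuits of the projected list are cocircuits of the original list. -/
theorem cocircuitIdeal_map_le [FiniteDimensional ℝ V] (hl : l a = 1) (hs : a ∈ s) {i₀ : κ}
    (hi : i₀ ∈ E) (ha : X i₀ = a) :
    cocircuitIdeal (transverse E X l a) (projAlong l a ∘ X) (s.map (projAlong l a)) ≤
      cocircuitIdeal E X s ⊔ Ideal.span {SymmetricAlgebra.ι ℝ V a} := by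
  refine Ideal.span_le.2 ?_
  rintro _ ⟨t, ht, hts, hd, rfl⟩
  have hmem : diffProd E X s (t ⊔ Submodule.span ℝ {a}) ∈ cocircuitIdeal E X s := by
    refine diffProd_mem_cocircuitIdeal (ht.sup hl hi ha) ?_ ?_
    · exact (sup_le_sup_right hts _).trans (map_projAlong_sup hs).le
    · rw [finrank_sup_of_dual hl (ht.dual_eq_zero hl), hd, finrank_map_projAlong hl hs]
  rw [← reduceAlong_diffProd hl hs ht,
    ← sub_sub_cancel (diffProd E X s (t ⊔ Submodule.span ℝ {a})) (reduceAlong l a _)]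
  exact sub_mem (Ideal.mem_sup_left hmem) (Ideal.mem_sup_right
    (Ideal.mem_span_singleton.2 (ι_dvd_sub_reduceAlong l a _)))

variable {K : Type*} [Field K] [Algebra (S V) K] [IsFractionRing (S V) K]

/-- The coefficient of the highest possible pole along `a` of a fraction with denominator the
product of the members in `s`. It vanishes for `a ∉ s`. -/
theorem coeff_laurentAlong_div_partProd (hX : ∀ i ∈ E, X i ≠ 0) (hl : l a = 1)
    {i₀ : κ} (hi : i₀ ∈ E) (ha : X i₀ = a) (f : S V) :
    (laurentAlong K l a (algebraMap (S V) K f / algebraMap (S V) K (partProd E X s))).coeff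
      (-((E.filter fun i => projAlong l a (X i) = 0).card : ℤ)) =
    if a ∈ s then
      algebraMap (S V) K (algebraMap ℝ (S V)
        (∏ i ∈ E.filter fun i => projAlong l a (X i) = 0, l (X i))⁻¹) *
      (algebraMap (S V) K (reduceAlong l a f) / algebraMap (S V) K
        (partProd (transverse E X l a) (projAlong l a ∘ X) (s.map (projAlong l a))))
    else 0 := by
  split_ifs with hs
  · have hprod : partProd E X s =
        (∏ i ∈ E.filter fun i => projAlong l a (X i) = 0, SymmetricAlgebra.ι ℝ V (X i)) *
          partProd (transverse E X l a) X s := by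
      rw [partProd, partProd, transverse, ← Finset.prod_filter_mul_prod_filter_not
        (E.filter fun i => X i ∈ s) (fun i => projAlong l a (X i) = 0), Finset.filter_filter,
        Finset.filter_comm (fun i => X i ∈ s)]
      congr 1
      refine Finset.prod_congr (Finset.filter_congr fun i _ => ?_) fun _ _ => rfl
      exact ⟨fun h => h.2, fun h => ⟨mem_of_projAlong_eq_zero h hs, h⟩⟩
    have hne : reduceAlong l a (partProd (transverse E X l a) X s) ≠ 0 := by
      rw [reduceAlong_partProd hl hs]
      exact partProd_ne_zero fun i hi => (mem_transverse.1 hi).2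
    rw [hprod, coeff_laurentAlong_div (fun i hi => (Finset.mem_filter.1 hi).2) f hne,
      reduceAlong_partProd hl hs]
  · have hne : reduceAlong l a (partProd E X s) ≠ 0 := by
      rw [partProd, reduceAlong_prod]
      refine Finset.prod_ne_zero_iff.2 fun i hi => ι_ne_zero fun h => hs ?_
      rw [Finset.mem_filter] at hi
      -- a nonzero multiple of `a` in `s` forces `a ∈ s`
      have h' : X i = l (X i) • a := by
        rwa [Function.comp_apply, projAlong_apply, sub_eq_zero] at h
      have hlu : l (X i) ≠ 0 := fun h0 => hX i hi.1 (by rw [h', h0, zero_smul])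
      exact (s.smul_mem_iff hlu).1 (h' ▸ hi.2)
    rw [laurentAlong_div l a f hne, coeff_ofPowerSeries_of_neg]
    have : 0 < (E.filter fun i => projAlong l a (X i) = 0).card :=
      Finset.card_pos.2 ⟨i₀, Finset.mem_filter.2 ⟨hi, ha.symm ▸ projAlong_self hl⟩⟩
    omega

end Contraction

end Cocircuit

/-! ### Separation of the subspaces modulo lower polar order -/

section Separation

open scoped Classical

variable {V : Type*} [AddCommGroup V] [Module ℝ V] [FiniteDimensional ℝ V] {κ : Type*}
  {K : Type*} [Field K] [Algebra (S V) K] [IsFractionRing (S V) K]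

/-- The leading polar coefficient along `a` of a sum of fractions of polar order less than `k`. -/
theorem sum_map_projAlong_mem_polarLT {E : Finset κ} {X : κ → V} {k : ℕ}
    {G : Finset (Submodule ℝ V)} {f : Submodule ℝ V → S V} (hX : ∀ i ∈ E, X i ≠ 0)
    (hsum : ∑ s ∈ G, algebraMap (S V) K (f s) / algebraMap (S V) K (partProd E X s) ∈
      polarLT V K k)
    {l : V →ₗ[ℝ] ℝ} {a : V} (hl : l a = 1) {i₀ : κ} (hi : i₀ ∈ E) (ha : X i₀ = a) :
    ∑ u ∈ (G.filter fun s => a ∈ s).image (Submodule.map (projAlong l a)),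
      algebraMap (S V) K (reduceAlong l a (f (u ⊔ Submodule.span ℝ {a}))) /
        algebraMap (S V) K (partProd (transverse E X l a) (projAlong l a ∘ X) u) ∈
      polarLT V K (k - 1) := by
  have hinj : Set.InjOn (Submodule.map (projAlong l a)) (G.filter fun s => a ∈ s) := by
    intro s hs t ht hst
    rw [Finset.mem_coe, Finset.mem_filter] at hs ht
    rw [← map_projAlong_sup (l := l) hs.2, hst, map_projAlong_sup ht.2]
  rw [Finset.sum_image hinj]
  have hcard : 0 < (E.filter fun i => projAlong l a (X i) = 0).card :=
    Finset.card_pos.2 ⟨i₀, Finset.mem_filter.2 ⟨hi, ha.symm ▸ projAlong_self hl⟩⟩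
  have hcoeff := coeff_laurentAlong_mem_polarLT hl hsum
    (n := -((E.filter fun i => projAlong l a (X i) = 0).card : ℤ)) (by omega)
  rw [map_sum, HahnSeries.coeff_sum, Finset.sum_congr rfl fun s _ =>
    coeff_laurentAlong_div_partProd hX hl hi ha (f s), ← Finset.sum_filter, ← Finset.mul_sum,
    ← Algebra.smul_def] at hcoeff
  set c : ℝ := ∏ i ∈ E.filter fun i => projAlong l a (X i) = 0, l (X i) with hc
  have hc0 : c ≠ 0 := by
    refine Finset.prod_ne_zero_iff.2 fun i hi h0 => ?_
    rw [Finset.mem_filter, projAlong_apply, sub_eq_zero, h0, zero_smul] at hi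
    exact hX i hi.1 hi.2
  have := (polarLT V K (k - 1)).smul_mem (algebraMap ℝ (S V) c) hcoeff
  rw [smul_smul, ← map_mul, mul_inv_cancel₀ hc0, map_one, one_smul] at this
  convert this using 1
  refine Finset.sum_congr rfl fun s hs => ?_
  rw [map_projAlong_sup (Finset.mem_filter.1 hs).2]

/-- Subspaces of the same dimension `k` contribute independently modulo polar order less than `k`:
if a sum of fractions `f s / ∏ {X i | X i ∈ s}` has polar order less than `k`, then every
numerator `f s` lies in the cocircuit ideal of `s`. The proof is by deletion of a vector `a` and
projection along it, the projection being applied to the leading polar coefficients along `a`. -/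
theorem mem_cocircuitIdeal_of_sum_mem_polarLT (K : Type*) [Field K] [Algebra (S V) K]
    [IsFractionRing (S V) K] (E : Finset κ) :
    ∀ (X : κ → V) (k : ℕ) (G : Finset (Submodule ℝ V)) (f : Submodule ℝ V → S V),
      (∀ i ∈ E, X i ≠ 0) → (∀ s ∈ G, IsSpannedIn E X s ∧ Module.finrank ℝ s = k) →
      ∑ s ∈ G, algebraMap (S V) K (f s) / algebraMap (S V) K (partProd E X s) ∈ polarLT V K k →
      ∀ s ∈ G, f s ∈ cocircuitIdeal E X s := by
  induction E using Finset.strongInduction with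
  | H E ih =>
  intro X k G f hX hG hsum
  obtain rfl | ⟨i₀, hi₀⟩ := E.eq_empty_or_nonempty
  · have hbot : ∀ s ∈ G, s = ⊥ := by
      intro s hs
      rw [← (hG s hs).1]
      simp
    intro s hs
    have hG1 : G = {s} := Finset.eq_singleton_iff_unique_mem.2
      ⟨hs, fun t ht => (hbot t ht).trans (hbot s hs).symm⟩
    have hk : k = 0 := by
      rw [← (hG s hs).2, hbot s hs, finrank_bot]
    have hp : partProd ∅ X s = 1 := by rw [partProd, Finset.filter_empty, Finset.prod_empty]
    rw [hG1, Finset.sum_singleton, hk, polarLT_zero, Submodule.mem_bot, hp, map_one, div_one,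
      map_eq_zero_iff _ (IsFractionRing.injective (S V) K)] at hsum
    rw [hsum]
    exact zero_mem _
  obtain ⟨a, ha⟩ : ∃ a, X i₀ = a := ⟨_, rfl⟩
  have ha0 : a ≠ 0 := ha ▸ hX i₀ hi₀
  obtain ⟨l, hl⟩ := Module.Projective.exists_dual_eq_one ℝ ha0
  have hp0 : ∀ {F : Finset κ}, F ⊆ E → ∀ s, algebraMap (S V) K (partProd F X s) ≠ 0 :=
    fun hF s => (map_ne_zero_iff _ (IsFractionRing.injective (S V) K)).2
      (partProd_ne_zero fun i hi => hX i (hF hi))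
  have ha0' : algebraMap (S V) K (SymmetricAlgebra.ι ℝ V a) ≠ 0 :=
    (map_ne_zero_iff _ (IsFractionRing.injective (S V) K)).2 (ι_ne_zero ha0)
  -- Projection along `a` determines the numerators modulo `a`.
  have hmod : ∀ s ∈ G, a ∈ s → ∃ c ∈ cocircuitIdeal E X s, ∃ g : S V,
      f s = c + SymmetricAlgebra.ι ℝ V a * g := by
    intro s hs has
    have hssub : transverse E X l a ⊂ E := by
      refine Finset.filter_ssubset.2 ⟨i₀, hi₀, ?_⟩
      rw [ha, projAlong_self hl]
      exact fun h => h rfl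
    have := ih _ hssub (projAlong l a ∘ X) (k - 1) _
      (fun u => reduceAlong l a (f (u ⊔ Submodule.span ℝ {a})))
      (fun i hi => (mem_transverse.1 hi).2) ?_
      (sum_map_projAlong_mem_polarLT hX hsum hl hi₀ ha) (s.map (projAlong l a))
      (Finset.mem_image_of_mem _ (Finset.mem_filter.2 ⟨hs, has⟩))
    · rw [map_projAlong_sup has] at this
      obtain ⟨c, hc, b, hb, hcb⟩ := Submodule.mem_sup.1 (cocircuitIdeal_map_le hl has hi₀ ha this)
      obtain ⟨g₁, rfl⟩ := Ideal.mem_span_singleton.1 hb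
      obtain ⟨g₂, hg₂⟩ := ι_dvd_sub_reduceAlong l a (f s)
      exact ⟨c, hc, g₁ + g₂, by rw [mul_add, ← hg₂, ← hcb]; ring⟩
    · intro u hu
      obtain ⟨t, ht, rfl⟩ := Finset.mem_image.1 hu
      rw [Finset.mem_filter] at ht
      refine ⟨(hG t ht.1).1.map hl ht.2, ?_⟩
      have h1 := finrank_map_projAlong hl ht.2
      have h2 := (hG t ht.1).2
      omega
  have hex : ∀ s, ∃ g : S V, s ∈ G →
      (a ∈ s → f s - SymmetricAlgebra.ι ℝ V a * g ∈ cocircuitIdeal E X s) ∧ (a ∉ s → g = f s) := by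
    intro s
    by_cases hs : s ∈ G
    · by_cases has : a ∈ s
      · obtain ⟨c, hc, g, hg⟩ := hmod s hs has
        exact ⟨g, fun _ => ⟨fun _ => by rwa [hg, add_sub_cancel_right], fun h => absurd has h⟩⟩
      · exact ⟨f s, fun _ => ⟨fun h => absurd h has, fun _ => rfl⟩⟩
    · exact ⟨0, fun h => absurd h hs⟩
  choose g hg using hex
  -- Cancelling `a` replaces the list by the list without `X i₀`, up to lower polar order.
  have hdiff : ∀ s ∈ G, algebraMap (S V) K (g s) / algebraMap (S V) K (partProd (E.erase i₀) X s) -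
      algebraMap (S V) K (f s) / algebraMap (S V) K (partProd E X s) ∈ polarLT V K k := by
    intro s hs
    by_cases has : a ∈ s
    · have h1 := div_partProd_mem_of_mem_cocircuitIdeal (K := K) hX ((hg s hs).1 has)
      rw [(hG s hs).2] at h1
      have h2 : algebraMap (S V) K (g s) / algebraMap (S V) K (partProd (E.erase i₀) X s) =
          algebraMap (S V) K (SymmetricAlgebra.ι ℝ V a * g s) /
            algebraMap (S V) K (partProd E X s) := by
        rw [partProd_erase_of_mem hi₀ (ha.symm ▸ has), map_mul, map_mul, ha,
          mul_div_mul_left _ _ ha0']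
      rw [h2, ← sub_div, ← map_sub, ← neg_sub, map_neg, neg_div]
      exact neg_mem h1
    · rw [partProd_erase_of_notMem (ha.symm ▸ has), (hg s hs).2 has, sub_self]
      exact zero_mem _
  -- Subspaces not spanned without `X i₀` contribute fractions with poles in a proper subspace.
  have hsum' : ∑ s ∈ G.filter (fun s => IsSpannedIn (E.erase i₀) X s),
      algebraMap (S V) K (g s) / algebraMap (S V) K (partProd (E.erase i₀) X s) ∈
        polarLT V K k := by
    have h1 := add_mem (sum_mem hdiff) hsum
    rw [← Finset.sum_add_distrib, Finset.sum_congr rfl fun s _ => sub_add_cancel _ _,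
      ← Finset.sum_filter_add_sum_filter_not G (fun s => IsSpannedIn (E.erase i₀) X s)] at h1
    refine (Submodule.add_mem_iff_left _ (sum_mem fun s hs => ?_)).1 h1
    rw [Finset.mem_filter] at hs
    have hd := finrank_span_erase (hG s hs.1).1 hs.2
    refine div_partProd_mem_polarLT
      (U := Submodule.span ℝ (X '' {i | i ∈ E.erase i₀ ∧ X i ∈ s})) ?_ ?_ _
    · have := (hG s hs.1).2
      omega
    · exact fun i hi his => Submodule.subset_span ⟨i, ⟨hi, his⟩, rfl⟩
  have hind := ih _ (Finset.erase_ssubset hi₀) X k _ g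
    (fun i hi => hX i (Finset.mem_of_mem_erase hi))
    (fun s hs => ⟨(Finset.mem_filter.1 hs).2, (hG s (Finset.mem_filter.1 hs).1).2⟩) hsum'
  intro s hs
  by_cases hspan : IsSpannedIn (E.erase i₀) X s
  · have hgs := hind s (Finset.mem_filter.2 ⟨hs, hspan⟩)
    by_cases has : a ∈ s
    · have := mul_mem_cocircuitIdeal_of_erase hgs
      rw [ha] at this
      rw [← sub_add_cancel (f s) (SymmetricAlgebra.ι ℝ V a * g s)]
      exact add_mem ((hg s hs).1 has) this
    · rw [← (hg s hs).2 has]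
      exact cocircuitIdeal_erase_le_of_notMem (ha.symm ▸ has) hgs
  · have has : a ∈ s := ha ▸ mem_of_not_isSpannedIn_erase (hG s hs).1 hspan
    have hι := ι_mem_cocircuitIdeal (hG s hs).1 hspan hi₀
    rw [ha] at hι
    rw [← sub_add_cancel (f s) (SymmetricAlgebra.ι ℝ V a * g s)]
    exact add_mem ((hg s hs).1 has) (Ideal.mul_mem_right _ _ hι)

end Separation

/-! ### Comparison with the polar filtration of the localization -/

section Comparison

open scoped Classical

variable {V : Type*} [AddCommGroup V] [Module ℝ V] {m : ℕ} {X : Fin m → V}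
  {s t : Submodule ℝ V}

theorem isRational_iff : IsRational X s ↔ IsSpannedIn Finset.univ X s := by
  have : Set.range X ∩ (s : Set V) = X '' {i | i ∈ Finset.univ ∧ X i ∈ s} := by
    ext v
    constructor
    · rintro ⟨⟨i, rfl⟩, hi⟩
      exact ⟨i, ⟨Finset.mem_univ i, hi⟩, rfl⟩
    · rintro ⟨i, hi, rfl⟩
      exact ⟨⟨i, rfl⟩, hi.2⟩
  rw [IsRational, IsSpannedIn, this]

theorem partProd_mul_dCompl (X : Fin m → V) (s : Submodule ℝ V) :
    partProd Finset.univ X s * dCompl X s = dProd X :=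
  Finset.prod_filter_mul_prod_filter_not _ _ _

theorem dCompl_mul_diffProd (h : t ≤ s) :
    dCompl X s * diffProd Finset.univ X s t = dCompl X t := by
  rw [dCompl, diffProd, dCompl, mul_comm, ← Finset.prod_filter_mul_prod_filter_not
    (Finset.univ.filter fun i => X i ∉ t) (fun i => X i ∈ s), Finset.filter_filter,
    Finset.filter_filter]
  congr 1 <;> refine Finset.prod_congr (Finset.filter_congr fun i _ => ?_) fun _ _ => rfl
  · exact and_comm
  · exact ⟨fun hi => ⟨fun h' => hi (h h'), hi⟩, fun hi => hi.2⟩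

theorem idealOf_anti (h : t ≤ s) : idealOf X t ≤ idealOf X s :=
  Ideal.span_singleton_le_span_singleton.2 ⟨_, (dCompl_mul_diffProd h).symm⟩

theorem idealOf_le_idealSum {Q : Set (Submodule ℝ V)} (h : s ∈ Q) : idealOf X s ≤ idealSum X Q :=
  le_iSup₂_of_le s h le_rfl

theorem idealSum_le {Q : Set (Submodule ℝ V)} {I : Ideal (S V)} (h : ∀ s ∈ Q, idealOf X s ≤ I) :
    idealSum X Q ≤ I :=
  iSup₂_le h

theorem exists_sum_of_mem_idealSum {Q : Set (Submodule ℝ V)} {x : S V} (hx : x ∈ idealSum X Q) :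
    ∃ (F : Finset (Submodule ℝ V)) (c : Submodule ℝ V → S V), (∀ s ∈ F, s ∈ Q) ∧
      x = ∑ s ∈ F, c s * dCompl X s := by
  have hle : idealSum X Q ≤ Ideal.span (dCompl X '' Q) :=
    idealSum_le fun s hs => Ideal.span_mono (Set.singleton_subset_iff.2 ⟨s, hs, rfl⟩)
  obtain ⟨c, hc, rfl⟩ := (Finsupp.mem_span_image_iff_linearCombination _).1 (hle hx)
  exact ⟨c.support, c, fun s hs => hc hs, rfl⟩

/-- Multiplication by `d_{X \ s}` turns the cocircuits in `s` into the generators of the ideals of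
the rational hyperplanes of `s`. -/
theorem mul_dCompl_mem_idealSum {c : S V} (hc : c ∈ cocircuitIdeal Finset.univ X s) {k : ℕ}
    (hk : Module.finrank ℝ s = k) {T : Set (Submodule ℝ V)}
    (hT : ∀ t ∈ rationalSubspacesOfDim X ((k : ℤ) - 1), t ≤ s → t ∈ T) :
    c * dCompl X s ∈ idealSum X T := by
  have hle : cocircuitIdeal Finset.univ X s ≤ Submodule.comap
      (LinearMap.mulRight (S V) (dCompl X s)) (idealSum X T) := by
    refine Ideal.span_le.2 ?_
    rintro _ ⟨t, ht, hts, hd, rfl⟩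
    change diffProd Finset.univ X s t * dCompl X s ∈ idealSum X T
    rw [mul_comm, dCompl_mul_diffProd hts]
    refine idealOf_le_idealSum (hT t ⟨isRational_iff.2 ht, by omega⟩ hts) ?_
    exact Ideal.mem_span_singleton_self _
  exact hle hc

theorem dInv_mul (X : Fin m → V) : dInv X * algebraMap (S V) (R X) (dProd X) = 1 := by
  rw [mul_comm]
  exact IsLocalization.Away.mul_invSelf (dProd X)

theorem idealOf_le_polarIdeal {j : ℤ} (h : (Module.finrank ℝ s : ℤ) ≤ j) [FiniteDimensional ℝ V] :
    idealOf X s ≤ polarIdeal X j := by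
  refine (Ideal.span_singleton_le_iff_mem _).2 ⟨?_, ?_⟩
  · exact Submodule.smul_mem _ _ (Submodule.mem_span_singleton_self _)
  · refine Submodule.subset_span ⟨1, fun i => if X i ∈ s then 1 else 0, ?_, ?_⟩
    · refine le_trans (Nat.cast_le.2 (Submodule.finrank_mono (Submodule.span_le.2 ?_))) h
      rintro _ ⟨i, hi, rfl⟩
      by_contra h'
      exact hi (if_neg h')
    · have : (∏ i, SymmetricAlgebra.ι ℝ V (X i) ^ (if X i ∈ s then 1 else 0)) =
          partProd Finset.univ X s := by
        rw [partProd, Finset.prod_filter]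
        refine Finset.prod_congr rfl fun i _ => ?_
        split_ifs <;> simp
      rw [this, LinearMap.toSpanSingleton_apply, Algebra.smul_def, mul_assoc, mul_left_comm,
        ← map_mul, mul_comm (dCompl X s), partProd_mul_dCompl, dInv_mul, map_one]

theorem dProd_ne_zero (hX : ∀ i, X i ≠ 0) : dProd X ≠ 0 :=
  Finset.prod_ne_zero_iff.2 fun i _ => ι_ne_zero (hX i)

variable (K : Type*) [Field K] [Algebra (S V) K] [IsFractionRing (S V) K]

/-- The embedding of `R_X` into the fraction field of `S[V]`. -/
noncomputable def toFractionField (hX : ∀ i, X i ≠ 0) : R X →ₐ[S V] K where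
  __ := IsLocalization.Away.lift (S := R X) (g := algebraMap (S V) K) (dProd X)
    (isUnit_iff_ne_zero.2 ((map_ne_zero_iff _ (IsFractionRing.injective (S V) K)).2
      (dProd_ne_zero hX)))
  commutes' f := IsLocalization.Away.lift_eq _ _ f

variable {K}

theorem toFractionField_dInv (hX : ∀ i, X i ≠ 0) :
    toFractionField K hX (dInv X) = (algebraMap (S V) K (dProd X))⁻¹ := by
  refine eq_inv_of_mul_eq_one_left ?_
  rw [← AlgHom.commutes (toFractionField K hX), ← map_mul, dInv_mul, map_one]

theorem toFractionField_mem_polarLT (hX : ∀ i, X i ≠ 0) {k : ℕ} {q : R X}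
    (hq : q ∈ polarFiltration X ((k : ℤ) - 1)) : toFractionField K hX q ∈ polarLT V K k := by
  have hle : polarFiltration X ((k : ℤ) - 1) ≤
      (polarLT V K k).comap (toFractionField K hX).toLinearMap := by
    refine Submodule.span_le.2 ?_
    rintro q ⟨f, n, hn, hq⟩
    change toFractionField K hX q ∈ polarLT V K k
    have hne : algebraMap (S V) K (∏ i, SymmetricAlgebra.ι ℝ V (X i) ^ n i) ≠ 0 :=
      (map_ne_zero_iff _ (IsFractionRing.injective (S V) K)).2
        (Finset.prod_ne_zero_iff.2 fun i _ => pow_ne_zero _ (ι_ne_zero (hX i)))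
    have h1 := congrArg (toFractionField K hX) hq
    rw [map_mul, AlgHom.commutes, AlgHom.commutes, ← eq_mul_inv_iff_mul_eq₀ hne] at h1
    rw [h1]
    refine mem_polarLT (U := Submodule.span ℝ (X '' {i | n i ≠ 0})) (by omega) ?_
    exact mul_mem (Subalgebra.algebraMap_mem _ _) (inv_prod_mem_polesIn n fun i _ hi =>
      Submodule.subset_span ⟨i, hi, rfl⟩)
  exact hle hq

theorem div_dProd_mem_polarLT (hX : ∀ i, X i ≠ 0) {k : ℕ} {f : S V}
    (hf : f ∈ polarIdeal X ((k : ℤ) - 1)) :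
    algebraMap (S V) K f / algebraMap (S V) K (dProd X) ∈ polarLT V K k := by
  have := toFractionField_mem_polarLT (K := K) hX (Submodule.mem_inf.1 hf).2
  rwa [LinearMap.toSpanSingleton_apply, map_smul, toFractionField_dInv, Algebra.smul_def,
    ← div_eq_mul_inv] at this

theorem mul_dCompl_div_dProd (hX : ∀ i, X i ≠ 0) (c : S V) (s : Submodule ℝ V) :
    algebraMap (S V) K (c * dCompl X s) / algebraMap (S V) K (dProd X) =
      algebraMap (S V) K c / algebraMap (S V) K (partProd Finset.univ X s) := by
  have hne : algebraMap (S V) K (dCompl X s) ≠ 0 :=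
    (map_ne_zero_iff _ (IsFractionRing.injective (S V) K)).2
      (Finset.prod_ne_zero_iff.2 fun i _ => ι_ne_zero (hX i))
  rw [← partProd_mul_dCompl X s, map_mul, map_mul, mul_div_mul_right _ _ hne]

theorem sum_mul_dCompl_div_dProd (hX : ∀ i, X i ≠ 0) (F : Finset (Submodule ℝ V))
    (c : Submodule ℝ V → S V) :
    algebraMap (S V) K (∑ s ∈ F, c s * dCompl X s) / algebraMap (S V) K (dProd X) =
      ∑ s ∈ F, algebraMap (S V) K (c s) / algebraMap (S V) K (partProd Finset.univ X s) := by
  rw [map_sum, Finset.sum_div]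
  exact Finset.sum_congr rfl fun s _ => mul_dCompl_div_dProd hX _ _

end Comparison

/-! ### Intersections with the polar ideals -/

section Intersections

open scoped Classical

variable {V : Type*} [AddCommGroup V] [Module ℝ V] [FiniteDimensional ℝ V] {m : ℕ} {X : Fin m → V}

theorem idealSum_inf_polarIdeal (hX : ∀ i, X i ≠ 0) {k : ℕ} {G : Set (Submodule ℝ V)}
    (hG : G ⊆ rationalSubspacesOfDim X k) :
    idealSum X G ⊓ polarIdeal X ((k : ℤ) - 1) =
      idealSum X {t | t ∈ rationalSubspacesOfDim X ((k : ℤ) - 1) ∧ ∃ s ∈ G, t ≤ s} := by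
  apply le_antisymm
  · rintro x ⟨hx, hx'⟩
    obtain ⟨F, c, hF, rfl⟩ := exists_sum_of_mem_idealSum hx
    have hsum := div_dProd_mem_polarLT (K := FractionRing (S V)) hX hx'
    rw [sum_mul_dCompl_div_dProd hX] at hsum
    have hk : ∀ s ∈ F, Module.finrank ℝ s = k := fun s hs => Nat.cast_injective (hG (hF s hs)).2
    have hc := mem_cocircuitIdeal_of_sum_mem_polarLT (FractionRing (S V)) Finset.univ X k F c
      (fun i _ => hX i) (fun s hs => ⟨isRational_iff.1 (hG (hF s hs)).1, hk s hs⟩) hsum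
    exact sum_mem fun s hs => mul_dCompl_mem_idealSum (hc s hs) (hk s hs)
      fun t ht hts => ⟨ht, s, hF s hs, hts⟩
  · refine idealSum_le ?_
    rintro t ⟨ht, s, hs, hts⟩
    exact le_inf ((idealOf_anti hts).trans (idealOf_le_idealSum hs)) (idealOf_le_polarIdeal ht.2.le)

theorem idealOf_inf_polarIdeal (hX : ∀ i, X i ≠ 0) {k : ℕ} {s : Submodule ℝ V}
    (hs : s ∈ rationalSubspacesOfDim X k) :
    idealOf X s ⊓ polarIdeal X ((k : ℤ) - 1) =
      idealSum X {t | t ∈ rationalSubspacesOfDim X ((k : ℤ) - 1) ∧ t ≤ s} := by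
  have h := idealSum_inf_polarIdeal hX (Set.singleton_subset_iff.2 hs)
  simpa [idealSum] using h

theorem idealOf_inf_idealSum_diff (hX : ∀ i, X i ≠ 0) {Q : Set (Submodule ℝ V)}
    (hQ : IsAdmissible X Q) {k : ℕ} {s : Submodule ℝ V} (hs : s ∈ Q)
    (hk : Module.finrank ℝ s = k) (hmax : ∀ t ∈ Q, Module.finrank ℝ t ≤ k) :
    idealOf X s ⊓ idealSum X (Q \ {s}) =
      idealSum X {t | t ∈ rationalSubspacesOfDim X ((k : ℤ) - 1) ∧ t ≤ s} := by
  apply le_antisymm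
  · rintro x ⟨hxs, hx⟩
    obtain ⟨b, rfl⟩ := Ideal.mem_span_singleton'.1 hxs
    obtain ⟨F, c, hF, hsum⟩ := exists_sum_of_mem_idealSum hx
    have hsF : s ∉ F.filter (fun t : Submodule ℝ V => Module.finrank ℝ t = k) :=
      fun h => (hF s (Finset.mem_filter.1 h).1).2 rfl
    have h1 := sum_mul_dCompl_div_dProd (K := FractionRing (S V)) hX F c
    rw [← hsum, mul_dCompl_div_dProd hX, ← Finset.sum_filter_add_sum_filter_not F
      (fun t : Submodule ℝ V => Module.finrank ℝ t = k), ← sub_eq_iff_eq_add'] at h1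
    -- The terms of dimension less than `k` are moved to the side of lower polar order.
    have h2 : ∑ t ∈ insert s (F.filter fun t : Submodule ℝ V => Module.finrank ℝ t = k),
        algebraMap (S V) (FractionRing (S V)) (if t = s then b else -c t) /
          algebraMap (S V) (FractionRing (S V)) (partProd Finset.univ X t) ∈
        polarLT V (FractionRing (S V)) k := by
      rw [Finset.sum_insert hsF, if_pos rfl, Finset.sum_congr rfl (g := fun t =>
        -(algebraMap (S V) (FractionRing (S V)) (c t) /
          algebraMap (S V) (FractionRing (S V)) (partProd Finset.univ X t))) fun t ht => by
          rw [if_neg fun h : t = s => hsF (h ▸ ht), map_neg]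
          exact neg_div _ _,
        Finset.sum_neg_distrib, ← sub_eq_add_neg, h1]
      refine sum_mem fun t ht => ?_
      rw [Finset.mem_filter] at ht
      exact div_partProd_mem_polarLT (U := t) (lt_of_le_of_ne (hmax t (hF t ht.1).1) ht.2)
        (fun i _ h => h) _
    have h3 := mem_cocircuitIdeal_of_sum_mem_polarLT (FractionRing (S V)) Finset.univ X k _ _
      (fun i _ => hX i) ?_ h2 s (Finset.mem_insert_self _ _)
    · rw [if_pos rfl] at h3
      exact mul_dCompl_mem_idealSum h3 hk fun t ht hts => ⟨ht, hts⟩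
    · intro t ht
      obtain rfl | ht := Finset.mem_insert.1 ht
      · exact ⟨isRational_iff.1 (hQ.rational hs), hk⟩
      · rw [Finset.mem_filter] at ht
        exact ⟨isRational_iff.1 (hQ.rational (hF t ht.1).1), ht.2⟩
  · refine idealSum_le ?_
    rintro t ⟨ht, hts⟩
    refine le_inf (idealOf_anti hts) (idealOf_le_idealSum ⟨hQ.down_closed s hs t ht.1 hts, ?_⟩)
    rintro rfl
    have := ht.2
    omega

end Intersections

end PolarOrder

theorem mainTheorem6 {V : Type*} [AddCommGroup V] [Module ℝ V] [FiniteDimensional ℝ V]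
    {m : ℕ} (X : Fin m → V) (hX0 : ∀ i, X i ≠ 0)
    (hXspan : Submodule.span ℝ (Set.range X) = ⊤) :
    (∀ (k : ℕ) (G : Set (Submodule ℝ V)), G ⊆ PolarOrder.rationalSubspacesOfDim X k →
      PolarOrder.idealSum X G ⊓ PolarOrder.polarIdeal X ((k : ℤ) - 1) =
        PolarOrder.idealSum X
          {t | t ∈ PolarOrder.rationalSubspacesOfDim X ((k : ℤ) - 1) ∧ ∃ s ∈ G, t ≤ s}) ∧
    (∀ (Q : Set (Submodule ℝ V)), PolarOrder.IsAdmissible X Q →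
      ∀ (k : ℕ), ∀ s ∈ Q, Module.finrank ℝ s = k →
        (∀ t ∈ Q, Module.finrank ℝ t ≤ k) →
        PolarOrder.idealOf X s ⊓ PolarOrder.idealSum X (Q \ {s}) =
            PolarOrder.idealOf X s ⊓ PolarOrder.polarIdeal X ((k : ℤ) - 1) ∧
        PolarOrder.idealOf X s ⊓ PolarOrder.polarIdeal X ((k : ℤ) - 1) =
            PolarOrder.idealSum X
              {t | t ∈ PolarOrder.rationalSubspacesOfDim X ((k : ℤ) - 1) ∧ t ≤ s}) := by
  refine ⟨fun k G hG => PolarOrder.idealSum_inf_polarIdeal hX0 hG, fun Q hQ k s hs hk hmax => ?_⟩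
  have h := PolarOrder.idealOf_inf_polarIdeal hX0 (k := k)
    (show s ∈ PolarOrder.rationalSubspacesOfDim X k from ⟨hQ.rational hs, by rw [hk]⟩)
  exact ⟨(PolarOrder.idealOf_inf_idealSum_diff hX0 hQ hs hk hmax).trans h.symm, h⟩
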